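/- Let $R$ be a commutative noetherian ring; $\otimes=\otimes_R$ and $(-)^*=\mathrm{Hom}_R(-,R)$. A right-right entwining structure $(A,C,\psi)$ consists of an $R$-algebra $A$, an $R$-coalgebra $C$ and an $R$-linear map $\psi:C\otimes A\to A\otimes C$, $c\otimes a\mapsto\sum a_\psi\otimes c^\psi$, with $$\sum (ab)_\psi\otimes c^\psi=\sum a_\psi b_\Psi\otimes c^{\psi\Psi},\quad \sum 1_\psi\otimes c^\psi=1\otimes c,\quad \sum a_\psi\otimes\Delta(c^\psi)=\sum a_{\psi\Psi}\otimes c_1^{\Psi}\otimes c_2^{\psi},\quad \sum\varepsilon(c^\psi)a_\psi=\varepsilon(c)a .$$ An entwined module over $(A,C,\psi)$ is a right $A$-module and right $C$-comodule $M$ with $\varrho(ma)=\sum m_{<0>}a_\psi\otimes m_{<1>}^\psi$; morphisms are the $A$-linear $C$-colinear maps, and the category is denoted $\mathcal M_A^C(\psi)$. A measuring pairing $(A,C)$ is an algebra morphism $A\to C^*$, $a\mapsto\langle a,-\rangle$, into the convolution algebra $C^*$; it satisfies the $\alpha$-condition if $\alpha_M:M\otimes C\to\mathrm{Hom}_R(A,M)$,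 $m\otimes c\mapsto[a\mapsto m\langle a,c\rangle]$, is injective for every $R$-module $M$. For a left $A$-module $X$, $\mathrm{Rat}^C({}_AX)$ is the set of $x\in X$ for which $[a\mapsto ax]$ lies in the image of $\alpha_X$. An embedding $K\subseteq M$ of $R$-modules is pure if $K\otimes N\to M\otimes N$ is injective for every $R$-module $N$. The finite dual $A^\circ$ is the set of $f\in A^*$ for which $AfA\subseteq A^*$, the $R$-span of the functionals $x\mapsto f(bxa)$ with $a,b\in A$, is finitely generated over $R$. $A$ is an $\alpha$-algebra if $A^\circ\subseteq R^A$ is pure. Let $(A,C,\psi)$ be a right-right entwining structure with $A$ an $\alpha$-algebra. Let $\widetilde A\subseteq C^*$ be a (unital) $R$-subalgebra and let $\widetilde C\subseteq A^\circ$ be an $R$-subcoalgebra, that is, a pure $R$-submodule such that for every $f\in\widetilde C$ the functional $a\otimes b\mapsto f(ab)$ lies in the image of $\widetilde C\otimes\widetilde C\to(A\otimes A)^*$; this defines $\Delta(f)$, and $\varepsilon(f)=f(1)$. Then $(\widetilde A,C)$ and $(A,\widetilde C)$ are measuring pairings by evaluation. Let $\varphi:\widetilde C\otimes\widetilde A\to\widetilde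 A\otimes\widetilde C$, $f\otimes g\mapsto\sum g_\varphi\otimes f^\varphi$, be an $R$-linear map with $$\sum g_\varphi(c)f^\varphi(a)=\sum f(a_\psi)g(c^\psi)\qquad(f\in\widetilde C,\ g\in\widetilde A,\ a\in A,\ c\in C).$$ Then $(\widetilde A,\widetilde C,\varphi)$ is a right-right entwining structure, and the following hold. 1. For $M\in\mathcal M_A^C(\psi)$ regard $M^*$ as a left $A$-module by $(ah)(m)=h(ma)$ and as a right $\widetilde A$-module by $(hg)(m)=\sum h(m_{<0>})g(m_{<1>})$. Then $M_r:=\mathrm{Rat}^{\widetilde C}({}_AM^*)$ is an entwined module over $(\widetilde A,\widetilde C,\varphi)$: there is exactly one such structure on the $R$-module $M_r$ whose $\widetilde A$-action is the restriction of that of $M^*$ and whose coaction $h\mapsto\sum h_{<0>}\otimes h_{<1>}$ satisfies $ah=\sum h_{<0>}h_{<1>}(a)$ for all $a\in A$. If $f:M\to N$ is a morphism in $\mathcal M_A^C(\psi)$, then $f^*(N_r)\subseteq M_r$ and $f^*:N_r\to M_r$ is $\widetilde A$-linear and $\widetilde C$-colinear. 2. Suppose that the pairing $(\widetilde A,C)$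 satisfies the $\alpha$-condition. For $K\in\mathcal M_{\widetilde A}^{\widetilde C}(\varphi)$ regard $K^*$ as a left $\widetilde A$-module by $(gf)(k)=f(kg)$ and as a right $A$-module by $(fa)(k)=\sum f(k_{<0>})k_{<1>}(a)$. Then $K^r:=\mathrm{Rat}^{C}({}_{\widetilde A}K^*)$ is an entwined module over $(A,C,\psi)$: there is exactly one such structure on the $R$-module $K^r$ whose $A$-action is the restriction of that of $K^*$ and whose coaction $f\mapsto\sum f_{<0>}\otimes f_{<1>}$ satisfies $gf=\sum f_{<0>}g(f_{<1>})$ for all $g\in\widetilde A$. If $g:K\to L$ is a morphism in $\mathcal M_{\widetilde A}^{\widetilde C}(\varphi)$, then $g^*(L^r)\subseteq K^r$ and $g^*:L^r\to K^r$ is $A$-linear and $C$-colinear. -/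

import Mathlib

open TensorProduct Coalgebra

universe u

namespace DualEntwining

noncomputable section

section Pairings

variable {R : Type u} [CommRing R]

/-- An embedding `i : K → M` is pure (in the sense of Cohn) if `i ⊗ id : K ⊗ N → M ⊗ N` is
injective for every module `N`. -/
def IsPureMap {K M : Type u} [AddCommMonoid K] [Module R K] [AddCommMonoid M] [Module R M]
    (i : K →ₗ[R] M) : Prop :=
  ∀ (N : Type u) [AddCommGroup N] [Module R N], Function.Injective (i.rTensor N)

/-- The map `M ⊗ C → M`, `m ⊗ c ↦ f(c) m`, given by a functional `f` on `C`. -/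
def contract {C : Type u} [AddCommMonoid C] [Module R C] (f : Module.Dual R C)
    (M : Type u) [AddCommMonoid M] [Module R M] : M ⊗[R] C →ₗ[R] M :=
  (TensorProduct.rid R M).toLinearMap ∘ₗ f.lTensor M

@[simp]
theorem contract_tmul {C : Type u} [AddCommMonoid C] [Module R C] (f : Module.Dual R C)
    {M : Type u} [AddCommMonoid M] [Module R M] (m : M) (c : C) :
    contract f M (m ⊗ₜ[R] c) = f c • m := by
  simp [contract]

variable (R) in
/-- A measuring pairing `(A, C)`: a morphism of algebras from `A` to the dual `C^*` of the
coalgebra `C`, where `C^*` carries the convolution product. -/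
abbrev MeasuringPairing (A C : Type u) [Semiring A] [Algebra R A]
    [AddCommMonoid C] [Module R C] [Coalgebra R C] : Type u :=
  A →ₐ[R] WithConv (C →ₗ[R] R)

variable {A C : Type u} [Semiring A] [Algebra R A] [AddCommMonoid C] [Module R C] [Coalgebra R C]

/-- The linear map `A → C^*`, `a ↦ <a, ->`, underlying a measuring pairing. -/
def MeasuringPairing.toDual (κ : MeasuringPairing R A C) : A →ₗ[R] Module.Dual R C :=
  (WithConv.linearEquiv R (C →ₗ[R] R)).toLinearMap ∘ₗ κ.toLinearMap

/-- The measuring pairing `(B, C)` given by a subalgebra `B` of the dual algebra `C^*`, with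
`<g, c> = g(c)`. -/
def inclusionPairing (B : Subalgebra R (WithConv (C →ₗ[R] R))) : MeasuringPairing R B C :=
  B.val

/-- The map `α_M : M ⊗ C → Hom(A, M)`, `m ⊗ c ↦ (a ↦ <a, c> m)`. -/
def alphaMap (κ : MeasuringPairing R A C) (M : Type u) [AddCommMonoid M] [Module R M] :
    M ⊗[R] C →ₗ[R] A →ₗ[R] M :=
  ((LinearMap.compRight R (TensorProduct.rid R M).toLinearMap ∘ₗ LinearMap.lTensorHom M) ∘ₗ
    MeasuringPairing.toDual κ).flip

theorem alphaMap_apply (κ : MeasuringPairing R A C) (M : Type u) [AddCommMonoid M] [Module R M]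
    (t : M ⊗[R] C) (a : A) :
    alphaMap κ M t a = contract (MeasuringPairing.toDual κ a) M t := rfl

/-- The `α`-condition for a measuring pairing: all the maps `α_M` are injective. -/
def AlphaCondition (κ : MeasuringPairing R A C) : Prop :=
  ∀ (M : Type u) [AddCommGroup M] [Module R M], Function.Injective (alphaMap κ M)

/-- For a left `A`-module `X`, with action `τ`, the rational part `Rat^C(X) = ρ⁻¹(X ⊗ C)`, where
`ρ : X → Hom(A, X)`, `x ↦ (a ↦ a x)`, and `X ⊗ C` is mapped to `Hom(A, X)` by `α_X`. -/
def Rat (κ : MeasuringPairing R A C) {X : Type u} [AddCommMonoid X] [Module R X]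
    (τ : A →ₐ[R] Module.End R X) : Submodule R X :=
  (LinearMap.range (alphaMap κ X)).comap (LinearMap.flip τ.toLinearMap)

end Pairings

section EntwinedModules

variable {R : Type u} [CommRing R]
  {A C : Type u} [Semiring A] [Algebra R A] [AddCommMonoid C] [Module R C] [Coalgebra R C]

/-- The axioms of a right-right entwining structure `(A, C, ψ)`, with
`ψ(c ⊗ a) = ∑ a_ψ ⊗ c^ψ`. -/
structure IsEntwining (ψ : C ⊗[R] A →ₗ[R] A ⊗[R] C) : Prop where
  /-- `∑ (ab)_ψ ⊗ c^ψ = ∑ a_ψ b_Ψ ⊗ c^{ψΨ}` -/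
  map_mul : ∀ (c : C) (a b : A),
    ψ (c ⊗ₜ (a * b)) =
      (LinearMap.mul' R A).rTensor C ((TensorProduct.assoc R A A C).symm
        (ψ.lTensor A (TensorProduct.assoc R A C A (ψ (c ⊗ₜ a) ⊗ₜ b))))
  /-- `∑ 1_ψ ⊗ c^ψ = 1 ⊗ c` -/
  map_one : ∀ c : C, ψ (c ⊗ₜ 1) = 1 ⊗ₜ c
  /-- `∑ a_ψ ⊗ Δ(c^ψ) = ∑ a_{ψΨ} ⊗ c_1^Ψ ⊗ c_2^ψ` -/
  comul : ∀ (c : C) (a : A),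
    (comul (R := R) (A := C)).lTensor A (ψ (c ⊗ₜ a)) =
      TensorProduct.assoc R A C C (ψ.rTensor C ((TensorProduct.assoc R C A C).symm
        (ψ.lTensor C (TensorProduct.assoc R C C A (comul (R := R) c ⊗ₜ a)))))
  /-- `∑ ε(c^ψ) a_ψ = ε(c) a` -/
  counit : ∀ (c : C) (a : A),
    contract (counit (R := R) (A := C)) A (ψ (c ⊗ₜ a)) = counit (R := R) c • a

/-- The bilinear map `(m, a) ↦ m a` of a right `A`-module `M`, the right action being given by an
algebra morphism from the opposite algebra of `A` to `End(M)`. -/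
def rightAction {M : Type u} [AddCommMonoid M] [Module R M]
    (σ : Aᵐᵒᵖ →ₐ[R] Module.End R M) : M →ₗ[R] A →ₗ[R] M :=
  (σ.toLinearMap ∘ₗ (MulOpposite.opLinearEquiv R).toLinearMap).flip

/-- The structure of a right-right entwined module over `(A, C, ψ)` on an `R`-module `M`: a right
`A`-module structure and a right `C`-comodule structure, compatible through `ψ`. -/
@[ext]
structure EntwinedModule (ψ : C ⊗[R] A →ₗ[R] A ⊗[R] C)
    (M : Type u) [AddCommMonoid M] [Module R M] where
  /-- the right `A`-module structure -/
  act : Aᵐᵒᵖ →ₐ[R] Module.End R M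
  /-- the right `C`-coaction `m ↦ ∑ m_0 ⊗ m_1` -/
  coact : M →ₗ[R] M ⊗[R] C
  coassoc : ∀ m : M,
    TensorProduct.assoc R M C C (coact.rTensor C (coact m)) =
      (comul (R := R) (A := C)).lTensor M (coact m)
  coact_counit : ∀ m : M, contract (counit (R := R) (A := C)) M (coact m) = m
  /-- `ρ(m a) = ∑ m_0 a_ψ ⊗ m_1^ψ` -/
  compat : ∀ (m : M) (a : A),
    coact (rightAction act m a) =
      (TensorProduct.lift (rightAction act)).rTensor C ((TensorProduct.assoc R M A C).symm
        (ψ.lTensor M (TensorProduct.assoc R M C A (coact m ⊗ₜ a))))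

variable {ψ : C ⊗[R] A →ₗ[R] A ⊗[R] C}
  {M N : Type u} [AddCommMonoid M] [Module R M] [AddCommMonoid N] [Module R N]

/-- Morphisms of entwined modules: `A`-linear and `C`-colinear maps. -/
structure IsEntwinedHom (X : EntwinedModule ψ M) (Y : EntwinedModule ψ N)
    (f : M →ₗ[R] N) : Prop where
  linear : ∀ (m : M) (a : A), f (rightAction X.act m a) = rightAction Y.act (f m) a
  colinear : ∀ m : M, Y.coact (f m) = f.rTensor C (X.coact m)

/-- The left `A`-module structure `(a h)(m) = h(m a)` on the dual `M^*` of a right `A`-module. -/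
def dualLeft (σ : Aᵐᵒᵖ →ₐ[R] Module.End R M) : A →ₐ[R] Module.End R (Module.Dual R M) :=
  AlgHom.ofLinearMap
    { toFun := fun a => (σ (MulOpposite.op a)).dualMap
      map_add' := fun a b => by ext; simp
      map_smul' := fun r a => by ext; simp }
    (by ext; simp)
    (fun a b => by ext; simp)

variable {B D : Type u} [Semiring B] [Algebra R B] [AddCommMonoid D] [Module R D] [Coalgebra R D]

/-- The left action `b m = ∑ <b, m_1> m_0` of `B` on a right `C`-comodule, for a measuring pairing
`(B, C)`. -/
def comoduleAction (κ : MeasuringPairing R B C) (ρ : M →ₗ[R] M ⊗[R] C) :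
    B →ₗ[R] Module.End R M :=
  (alphaMap κ M ∘ₗ ρ).flip

/-- `Rat^D(_A M^*)`, for an entwined module `M` over `(A, C, ψ)` and a measuring pairing
`(A, D)`. -/
def ratDual (κ : MeasuringPairing R A D) (X : EntwinedModule ψ M) :
    Submodule R (Module.Dual R M) :=
  Rat κ (dualLeft X.act)

/-- `Y` is the structure of an entwined module over `(B, D, φ)` on `Rat^D(_A M^*)` induced from the
right `B`-module `M^*`, `(h b)(m) = h(b m)`, and from the left `A`-module `M^*`, that is, with the
coaction `h ↦ ∑ h_0 ⊗ h_1` for which `a h = ∑ <a, h_1> h_0`. -/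
structure IsDualStructure (κ : MeasuringPairing R A D) (κ' : MeasuringPairing R B C)
    {φ : D ⊗[R] B →ₗ[R] B ⊗[R] D}
    (X : EntwinedModule ψ M) (Y : EntwinedModule φ (ratDual κ X)) : Prop where
  act_eq : ∀ (h : ratDual κ X) (b : B) (m : M),
    (rightAction Y.act h b : Module.Dual R M) m =
      (h : Module.Dual R M) (comoduleAction κ' X.coact b m)
  coact_eq : ∀ (h : ratDual κ X) (a : A),
    (alphaMap κ (ratDual κ X) (Y.coact h) a : Module.Dual R M) =
      dualLeft X.act a (h : Module.Dual R M)

end EntwinedModules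

section FiniteDual

variable (R : Type u) [CommRing R] [IsNoetherianRing R] (A : Type u) [Ring A] [Algebra R A]

/-- The finite dual `A°` of an algebra over a noetherian ring: the functionals `f` for which the
subbimodule `A f A` of `A^*`, spanned by the functionals `x ↦ f(b x a)`, is finitely generated
over `R`. -/
def finiteDual : Submodule R (Module.Dual R A) where
  carrier := {f | (Submodule.span R (Set.range fun p : A × A =>
    f ∘ₗ LinearMap.mulLeftRight R p)).FG}
  zero_mem' := by
    have h : Submodule.span R (Set.range fun p : A × A =>
        (0 : Module.Dual R A) ∘ₗ LinearMap.mulLeftRight R p) = ⊥ := by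
      rw [Submodule.span_eq_bot]
      rintro _ ⟨p, rfl⟩
      simp
    change Submodule.FG _
    rw [h]
    exact Submodule.fg_bot
  add_mem' := by
    intro f g hf hg
    have hs := Submodule.FG.sup hf hg
    have := isNoetherian_of_fg_of_noetherian _ hs
    refine Submodule.FG.of_le_of_isNoetherian (S := Submodule.span R (Set.range fun p : A × A =>
      (f + g) ∘ₗ LinearMap.mulLeftRight R p)) (Submodule.span_le.2 ?_ : _ ≤
      Submodule.span R (Set.range fun p : A × A => f ∘ₗ LinearMap.mulLeftRight R p) ⊔
        Submodule.span R (Set.range fun p : A × A => g ∘ₗ LinearMap.mulLeftRight R p))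
    rintro _ ⟨p, rfl⟩
    simp only [LinearMap.add_comp]
    exact add_mem (Submodule.mem_sup_left (Submodule.subset_span ⟨p, rfl⟩))
      (Submodule.mem_sup_right (Submodule.subset_span ⟨p, rfl⟩))
  smul_mem' := by
    intro r f hf
    have := isNoetherian_of_fg_of_noetherian _ hf
    refine Submodule.FG.of_le_of_isNoetherian (S := Submodule.span R (Set.range fun p : A × A =>
      (r • f) ∘ₗ LinearMap.mulLeftRight R p)) (Submodule.span_le.2 ?_ : _ ≤
      Submodule.span R (Set.range fun p : A × A => f ∘ₗ LinearMap.mulLeftRight R p))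
    rintro _ ⟨p, rfl⟩
    simp only [LinearMap.smul_comp]
    exact Submodule.smul_mem _ _ (Submodule.subset_span ⟨p, rfl⟩)

/-- An `α`-algebra over a noetherian ring: `A° ⊆ R^A` is pure. -/
class IsAlphaAlgebra : Prop where
  pure : IsPureMap (LinearMap.ltoFun R A R R ∘ₗ (finiteDual R A).subtype)

/-- A subcoalgebra of the finite dual `A°` of an `α`-algebra `A`, that is, a pure submodule `D` of
`A°` with `Δ(D) ⊆ D ⊗ D`. The comultiplication of `A°` takes `f` to the unique element of
`A° ⊗ A° ⊆ (A ⊗ A)^*` that is the functional `a ⊗ b ↦ f(ab)`. -/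
structure FiniteDualSubcoalgebra extends Submodule R (Module.Dual R A) where
  le_finiteDual : toSubmodule ≤ finiteDual R A
  pure : IsPureMap (Submodule.inclusion le_finiteDual)
  comul_mem : ∀ f ∈ toSubmodule, f ∘ₗ LinearMap.mul' R A ∈
    LinearMap.range (TensorProduct.dualDistrib R A A ∘ₗ
      TensorProduct.mapIncl toSubmodule toSubmodule)

variable {R A}

/-- Over a noetherian ring, the canonical map `N ⊗ R^S → N^S` is injective. -/
theorem piScalarRightHom_injective (S N : Type u) [AddCommGroup N] [Module R N] :
    Function.Injective (TensorProduct.piScalarRightHom R R N S) := by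
  rw [injective_iff_map_eq_zero]
  intro x hx
  obtain ⟨T, rfl⟩ := TensorProduct.exists_finset x
  let π : (T → R) →ₗ[R] N := Fintype.linearCombination R (fun i : T => i.1.1)
  have hfg : (LinearMap.ker π).FG := IsNoetherian.noetherian _
  obtain ⟨n, k, hk⟩ := Submodule.fg_iff_exists_fin_generating_family.1 hfg
  have hker : ∀ s : S, (fun i : T => i.1.2 s) ∈ Submodule.span R (Set.range k) := by
    intro s
    rw [hk, LinearMap.mem_ker]
    have := congrFun hx s
    simp only [map_sum, TensorProduct.piScalarRightHom_tmul, Finset.sum_apply,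
      Pi.zero_apply] at this
    simp only [π, Fintype.linearCombination_apply]
    rw [← this, ← Finset.sum_coe_sort T]
  choose g hg using fun s => (Submodule.mem_span_range_iff_exists_fun R).1 (hker s)
  have hkk : ∀ j, ∑ i : T, k j i • i.1.1 = 0 := by
    intro j
    have : k j ∈ LinearMap.ker π := hk ▸ Submodule.subset_span ⟨j, rfl⟩
    simpa [π, Fintype.linearCombination_apply] using this
  have hf : ∀ i : T, i.1.2 = ∑ j, k j i • (fun s => g s j) := by
    intro i
    ext s
    have := congrFun (hg s) i
    simp only [Finset.sum_apply, Pi.smul_apply, smul_eq_mul] at this ⊢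
    rw [← this]
    exact Finset.sum_congr rfl fun _ _ => mul_comm _ _
  rw [← Finset.sum_coe_sort T]
  calc ∑ i : T, i.1.1 ⊗ₜ[R] i.1.2
      = ∑ i : T, ∑ j, (k j i • i.1.1) ⊗ₜ[R] (fun s => g s j) := by
        refine Finset.sum_congr rfl fun i _ => ?_
        conv_lhs => rw [hf i]
        rw [TensorProduct.tmul_sum]
        exact Finset.sum_congr rfl fun j _ => (TensorProduct.smul_tmul _ _ _).symm
    _ = 0 := by
        rw [Finset.sum_comm]
        simp_rw [← TensorProduct.sum_tmul, hkk, TensorProduct.zero_tmul]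
        simp

namespace FiniteDualSubcoalgebra

variable (D : FiniteDualSubcoalgebra R A)

/-- Evaluation of the functionals in `D` at `a`. -/
def eval : A →ₗ[R] Module.Dual R D.toSubmodule :=
  (Submodule.subtype D.toSubmodule).flip

@[simp]
theorem eval_apply (a : A) (f : D.toSubmodule) : D.eval a f = (f : Module.Dual R A) a := rfl

/-- The embedding `D ⊗ D → (A ⊗ A)^*`. -/
def embed : D.toSubmodule ⊗[R] D.toSubmodule →ₗ[R] Module.Dual R (A ⊗[R] A) :=
  TensorProduct.dualDistrib R A A ∘ₗ TensorProduct.mapIncl D.toSubmodule D.toSubmodule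

theorem embed_apply (t : D.toSubmodule ⊗[R] D.toSubmodule) (a b : A) :
    D.embed t (a ⊗ₜ b) = D.eval a (contract (D.eval b) D.toSubmodule t) := by
  induction t with
  | zero => simp
  | tmul f g => simp [embed, TensorProduct.mapIncl, mul_comm]
  | add x y hx hy => simp only [map_add, LinearMap.add_apply, hx, hy]

variable [IsAlphaAlgebra R A]

theorem eq_of_contract_eval {M : Type u} [AddCommMonoid M] [Module R M]
    {s t : M ⊗[R] D.toSubmodule}
    (h : ∀ a, contract (D.eval a) M s = contract (D.eval a) M t) : s = t := by
  let _ : AddCommGroup M := Module.addCommMonoidToAddCommGroup R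
  let i : D.toSubmodule →ₗ[R] (A → R) := LinearMap.ltoFun R A R R ∘ₗ
    (finiteDual R A).subtype ∘ₗ Submodule.inclusion D.le_finiteDual
  have hi : Function.Injective (i.lTensor M) := by
    rw [LinearMap.lTensor_inj_iff_rTensor_inj]
    have h1 := (IsAlphaAlgebra.pure (R := R) (A := A)) M
    have h2 := D.pure M
    have : i.rTensor M = (LinearMap.ltoFun R A R R ∘ₗ (finiteDual R A).subtype).rTensor M ∘ₗ
        (Submodule.inclusion D.le_finiteDual).rTensor M := by
      rw [← LinearMap.rTensor_comp]; rfl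
    rw [this]
    exact h1.comp h2
  apply hi
  apply piScalarRightHom_injective
  funext a
  have key : ∀ x : M ⊗[R] D.toSubmodule,
      TensorProduct.piScalarRightHom R R M A (i.lTensor M x) a = contract (D.eval a) M x := by
    intro x
    induction x with
    | zero => simp
    | tmul m f => simp [i]
    | add x y hx hy => simp only [map_add, Pi.add_apply, hx, hy]
  rw [key, key, h]

theorem embed_injective : Function.Injective D.embed := by
  intro s t h
  refine D.eq_of_contract_eval fun b => ?_
  ext a
  have := LinearMap.congr_fun h (a ⊗ₜ b)
  rwa [embed_apply, embed_apply] at this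

/-- The comultiplication of `D`, determined by `Δ(f)(a ⊗ b) = f(ab)`. -/
def comulMap : D.toSubmodule →ₗ[R] D.toSubmodule ⊗[R] D.toSubmodule :=
  (LinearEquiv.ofInjective D.embed D.embed_injective).symm.toLinearMap ∘ₗ
    LinearMap.codRestrict (LinearMap.range D.embed)
      ((LinearMap.mul' R A).dualMap ∘ₗ D.toSubmodule.subtype)
      (fun f => D.comul_mem f f.2)

theorem embed_comulMap (f : D.toSubmodule) :
    D.embed (D.comulMap f) = (f : Module.Dual R A) ∘ₗ LinearMap.mul' R A := by
  have h := LinearEquiv.apply_symm_apply (LinearEquiv.ofInjective D.embed D.embed_injective)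
    (LinearMap.codRestrict (LinearMap.range D.embed)
      ((LinearMap.mul' R A).dualMap ∘ₗ D.toSubmodule.subtype)
      (fun f => D.comul_mem f f.2) f)
  exact congrArg Subtype.val h

theorem contract_comulMap (f : D.toSubmodule) (a b : A) :
    (contract (D.eval b) D.toSubmodule (D.comulMap f) : Module.Dual R A) a =
      (f : Module.Dual R A) (a * b) := by
  rw [← eval_apply, ← embed_apply, embed_comulMap]
  simp

/-- The comultiplication and the counit `ε(f) = f(1)` of `D`. -/
instance : CoalgebraStruct R D.toSubmodule where
  comul := D.comulMap
  counit := D.eval 1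

theorem comul_eq (f : D.toSubmodule) : comul (R := R) f = D.comulMap f := rfl

theorem counit_eq : counit (R := R) (A := D.toSubmodule) = D.eval 1 := rfl

instance : Coalgebra R D.toSubmodule where
  coassoc := by
    ext f
    apply (TensorProduct.assoc R D.toSubmodule D.toSubmodule D.toSubmodule).symm.injective
    refine D.eq_of_contract_eval fun c => D.eq_of_contract_eval fun b => ?_
    ext a
    have h1 : ∀ t : D.toSubmodule ⊗[R] D.toSubmodule,
        contract (D.eval c) (D.toSubmodule ⊗[R] D.toSubmodule) (D.comulMap.rTensor _ t) =
          D.comulMap (contract (D.eval c) D.toSubmodule t) := by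
      intro t
      induction t with
      | zero => simp
      | tmul f g => simp
      | add x y hx hy => simp only [map_add, hx, hy]
    have h3 : ∀ (d : D.toSubmodule) (s : D.toSubmodule ⊗[R] D.toSubmodule),
        contract (D.eval b) D.toSubmodule
          (contract (D.eval c) (D.toSubmodule ⊗[R] D.toSubmodule)
            ((TensorProduct.assoc R D.toSubmodule D.toSubmodule D.toSubmodule).symm (d ⊗ₜ s))) =
          D.eval b (contract (D.eval c) D.toSubmodule s) • d := by
      intro d s
      induction s with
      | zero => simp
      | tmul f g => simp [mul_smul]
      | add x y hx hy => simp only [TensorProduct.tmul_add, map_add, hx, hy, add_smul]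
    have h2 : ∀ t : D.toSubmodule ⊗[R] D.toSubmodule,
        contract (D.eval b) D.toSubmodule
          (contract (D.eval c) (D.toSubmodule ⊗[R] D.toSubmodule)
            ((TensorProduct.assoc R D.toSubmodule D.toSubmodule D.toSubmodule).symm
              (D.comulMap.lTensor _ t))) =
          contract (D.eval (b * c)) D.toSubmodule t := by
      intro t
      induction t with
      | zero => simp
      | tmul f g =>
        rw [LinearMap.lTensor_tmul, h3, contract_tmul, eval_apply, contract_comulMap, eval_apply]
      | add x y hx hy => simp only [map_add, hx, hy]
    change _ = (contract (D.eval b) D.toSubmodule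
      (contract (D.eval c) (D.toSubmodule ⊗[R] D.toSubmodule)
        ((TensorProduct.assoc R D.toSubmodule D.toSubmodule D.toSubmodule).symm
          (D.comulMap.lTensor _ (D.comulMap f)))) : Module.Dual R A) a
    rw [h2]
    change (contract (D.eval b) D.toSubmodule
      (contract (D.eval c) (D.toSubmodule ⊗[R] D.toSubmodule)
        ((TensorProduct.assoc R D.toSubmodule D.toSubmodule D.toSubmodule).symm
          (TensorProduct.assoc R D.toSubmodule D.toSubmodule D.toSubmodule
            (D.comulMap.rTensor _ (D.comulMap f))))) : Module.Dual R A) a = _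
    rw [LinearEquiv.symm_apply_apply, h1, contract_comulMap, contract_comulMap,
      contract_comulMap, mul_assoc]
  rTensor_counit_comp_comul := by
    ext f
    apply (TensorProduct.lid R D.toSubmodule).injective
    ext b
    have h : ∀ t : D.toSubmodule ⊗[R] D.toSubmodule,
        (TensorProduct.lid R D.toSubmodule ((D.eval 1).rTensor _ t) : Module.Dual R A) b =
          D.eval 1 (contract (D.eval b) D.toSubmodule t) := by
      intro t
      induction t with
      | zero => simp
      | tmul f g => simp [mul_comm]
      | add x y hx hy =>
        simp only [map_add, hx, hy, Submodule.coe_add, LinearMap.add_apply]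
    change (TensorProduct.lid R D.toSubmodule ((D.eval 1).rTensor _ (D.comulMap f)) :
      Module.Dual R A) b = _
    rw [h, eval_apply, contract_comulMap]
    simp
  lTensor_counit_comp_comul := by
    ext f
    apply (TensorProduct.rid R D.toSubmodule).injective
    ext b
    change (contract (D.eval 1) D.toSubmodule (D.comulMap f) : Module.Dual R A) b = _
    rw [contract_comulMap]
    simp

/-- The measuring pairing `(A, D)`, with `<a, f> = f(a)`. -/
def pairing : MeasuringPairing R A D.toSubmodule :=
  AlgHom.ofLinearMap ((WithConv.linearEquiv R _).symm.toLinearMap ∘ₗ D.eval)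
    (by
      apply WithConv.ext
      ext f
      rfl)
    (fun a b => by
      apply WithConv.ext
      ext f
      have h : ∀ t : D.toSubmodule ⊗[R] D.toSubmodule,
          LinearMap.mul' R R (TensorProduct.map (D.eval a) (D.eval b) t) =
            D.eval a (contract (D.eval b) D.toSubmodule t) := by
        intro t
        induction t with
        | zero => simp
        | tmul f g => simp [mul_comm]
        | add x y hx hy => simp only [map_add, hx, hy]
      change (f : Module.Dual R A) (a * b) =
        LinearMap.mul' R R (TensorProduct.map (D.eval a) (D.eval b) (D.comulMap f))
      rw [h, eval_apply, contract_comulMap])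

end FiniteDualSubcoalgebra

end FiniteDual

end

end DualEntwining

/-! Write `D` for the subcoalgebra of $A^\circ$ and `B` for the subalgebra of $C^*$. Everything is
checked by contraction. An element of $N\otimes D$ is determined by its contractions with all $a\in
A$: $D\subseteq A^\circ\subseteq R^A$ is a composite of pure embeddings, and $N\otimes R^A\to N^A$
is injective over a noetherian ring. An element of $B\subseteq C^*$ is determined by its values on
$C$. The hypothesis on `φ` then says $\langle b_\varphi,c\rangle\langle a,d^\varphi\rangle=\langle
a_\psi,d\rangle\langle b,c^\psi\rangle$ (`IsDualPair`). Since products on one side pair with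
coproducts on the other, each axiom for `φ` is the transpose of one for `ψ`: multiplicativity and
comultiplicativity trade places, and so do the unit and counit axioms (`IsDualPair.isEntwining`).

For modules, the α-condition gives every rational part a unique coaction, with coassociativity
coming from associativity of the action (`ratCoact_coassoc`). The core is
`IsDualPair.contract_entwine`: the action of $a$ on $hb$ is represented by $\sum h_0b_\varphi\otimes
h_1^\varphi$. This shows both that the rational part is stable under `B` and that action and
coaction are compatible.

The duality identity is symmetric in the two pairings, so the second half of the theorem is the
first with the roles exchanged; only the α-condition for $(B,C)$ must then be assumed. -/

namespace DualEntwining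

/-! ### Calculus of contractions -/

section Contract

variable {R : Type u} [CommRing R]
  {C D M N : Type u} [AddCommMonoid C] [Module R C] [AddCommMonoid D] [Module R D]
  [AddCommMonoid M] [Module R M] [AddCommMonoid N] [Module R N]

theorem contract_rTensor (f : Module.Dual R C) (g : M →ₗ[R] N) (t : M ⊗[R] C) :
    contract f N (g.rTensor C t) = g (contract f M t) := by
  induction t with
  | zero => simp
  | tmul m c => simp
  | add x y hx hy => simp only [map_add, hx, hy]

theorem contract_lTensor (f : Module.Dual R D) (g : C →ₗ[R] D) (t : M ⊗[R] C) :
    contract f M (g.lTensor M t) = contract (f ∘ₗ g) M t := by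
  induction t with
  | zero => simp
  | tmul m c => simp
  | add x y hx hy => simp only [map_add, hx, hy]

theorem contract_assoc_symm_tmul (f : Module.Dual R C) (m : M) (s : N ⊗[R] C) :
    contract f (M ⊗[R] N) ((TensorProduct.assoc R M N C).symm (m ⊗ₜ s)) =
      m ⊗ₜ contract f N s := by
  induction s with
  | zero => simp
  | tmul n c => simp
  | add x y hx hy => simp only [map_add, TensorProduct.tmul_add, hx, hy]

/-- Contracting two tensor factors one after the other. -/
theorem contract_contract_assoc_symm (f : Module.Dual R C) (g : Module.Dual R D)
    (t : M ⊗[R] (C ⊗[R] D)) :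
    contract f M (contract g (M ⊗[R] C) ((TensorProduct.assoc R M C D).symm t)) =
      contract (LinearMap.mul' R R ∘ₗ TensorProduct.map f g) M t := by
  induction t with
  | zero => simp
  | tmul m s =>
    rw [contract_assoc_symm_tmul, contract_tmul, contract_tmul]
    congr 1
    induction s with
    | zero => simp
    | tmul c d => simp [mul_comm]
    | add x y hx hy => simp only [map_add, hx, hy]
  | add x y hx hy => simp only [map_add, hx, hy]

end Contract

/-! ### Measuring pairings and the α-condition -/

section Pairing

variable {R : Type u} [CommRing R] {A D : Type u} [Semiring A] [Algebra R A]
  [AddCommMonoid D] [Module R D] [Coalgebra R D] (κ : MeasuringPairing R A D)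

theorem toDual_one : MeasuringPairing.toDual κ 1 = counit (R := R) (A := D) := by
  ext d
  simp only [MeasuringPairing.toDual, LinearMap.comp_apply, AlgHom.toLinearMap_apply, map_one]
  change (1 : WithConv (D →ₗ[R] R)) d = _
  simp

theorem toDual_mul (a b : A) :
    MeasuringPairing.toDual κ (a * b) = (LinearMap.mul' R R ∘ₗ TensorProduct.map
      (MeasuringPairing.toDual κ a) (MeasuringPairing.toDual κ b)) ∘ₗ comul (R := R) := by
  simp only [MeasuringPairing.toDual, LinearMap.comp_apply, AlgHom.toLinearMap_apply, map_mul]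
  rfl

/-- Convolution is dual to comultiplication: pairing with a product amounts to applying `comul`,
then contracting the last factor with `b` and the middle one with `a`. -/
theorem contract_toDual_mul (a b : A) {M : Type u} [AddCommMonoid M] [Module R M]
    (t : M ⊗[R] D) :
    contract (MeasuringPairing.toDual κ (a * b)) M t =
      contract (MeasuringPairing.toDual κ a) M (contract (MeasuringPairing.toDual κ b) (M ⊗[R] D)
        ((TensorProduct.assoc R M D D).symm ((comul (R := R) (A := D)).lTensor M t))) := by
  rw [contract_contract_assoc_symm, contract_lTensor, toDual_mul]

variable {κ}

theorem AlphaCondition.ext (hκ : AlphaCondition κ) {M : Type u} [AddCommMonoid M] [Module R M]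
    {s t : M ⊗[R] D}
    (h : ∀ a, contract (MeasuringPairing.toDual κ a) M s =
      contract (MeasuringPairing.toDual κ a) M t) : s = t := by
  let _ : AddCommGroup M := Module.addCommMonoidToAddCommGroup R
  exact hκ M (LinearMap.ext h)

/-- A tensor in `X ⊗ D` all of whose contractions lie in `S ⊆ X` comes from `S ⊗ D`. -/
theorem AlphaCondition.exists_rTensor_subtype_eq (hκ : AlphaCondition κ) {X : Type u}
    [AddCommGroup X] [Module R X] (S : Submodule R X) (t : X ⊗[R] D)
    (h : ∀ a, contract (MeasuringPairing.toDual κ a) X t ∈ S) :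
    ∃ s : S ⊗[R] D, S.subtype.rTensor D s = t := by
  let _ : AddCommGroup D := Module.addCommMonoidToAddCommGroup R
  have hex : Function.Exact S.subtype S.mkQ := by
    rw [LinearMap.exact_iff]; simp
  -- The image of `t` in $(X/S)\otimes D$ has only zero contractions, so it vanishes by the
  -- α-condition for $X/S$; right exactness of the tensor product then lifts `t`. No purity of `S`
  -- is needed.
  refine (rTensor_exact D hex S.mkQ_surjective t).1 (hκ.ext fun a => ?_)
  rw [contract_rTensor, map_zero]
  exact (Submodule.Quotient.mk_eq_zero S).2 (h a)

end Pairing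

/-! ### Rational modules and their coaction -/

section Rational

variable {R : Type u} [CommRing R] {A D : Type u} [Semiring A] [Algebra R A]
  [AddCommMonoid D] [Module R D] [Coalgebra R D] {κ : MeasuringPairing R A D}
  {X : Type u} [AddCommGroup X] [Module R X] {τ : A →ₐ[R] Module.End R X}

theorem mem_Rat_iff {x : X} : x ∈ Rat κ τ ↔
    ∃ t : X ⊗[R] D, ∀ a, contract (MeasuringPairing.toDual κ a) X t = τ a x := by
  simp only [Rat, Submodule.mem_comap, LinearMap.mem_range]
  exact exists_congr fun t => LinearMap.ext_iff

/-- If $\sum x_0\otimes x_1$ represents `x`, then $\sum x_0\otimes x_{1,1}\langle a,x_{1,2}\rangle$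
represents $ax$, because $b(ax)=(ba)x$. -/
theorem map_mem_Rat {x : X} (hx : x ∈ Rat κ τ) (a : A) : τ a x ∈ Rat κ τ := by
  obtain ⟨t, ht⟩ := mem_Rat_iff.1 hx
  refine mem_Rat_iff.2 ⟨contract (MeasuringPairing.toDual κ a) (X ⊗[R] D)
    ((TensorProduct.assoc R X D D).symm ((comul (R := R) (A := D)).lTensor X t)), fun b => ?_⟩
  rw [← contract_toDual_mul, ht, map_mul, Module.End.mul_apply]

/-- Rationality only provides a tensor in $X\otimes D$. Its contractions are the elements $ax$,
which are again rational, so it descends to the rational part. -/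
theorem exists_coaction (hκ : AlphaCondition κ) (x : Rat κ τ) : ∃ s : Rat κ τ ⊗[R] D,
    ∀ a, (contract (MeasuringPairing.toDual κ a) (Rat κ τ) s : X) = τ a x := by
  obtain ⟨t, ht⟩ := mem_Rat_iff.1 x.2
  obtain ⟨s, rfl⟩ := hκ.exists_rTensor_subtype_eq (Rat κ τ) t
    fun a => ht a ▸ map_mem_Rat x.2 a
  refine ⟨s, fun a => ?_⟩
  rw [← ht, contract_rTensor]
  rfl

/-- The coaction of the rational part of a left `A`-module, for a pairing satisfying the
`α`-condition. -/
noncomputable def ratCoact (hκ : AlphaCondition κ) : Rat κ τ →ₗ[R] Rat κ τ ⊗[R] D where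
  toFun x := (exists_coaction hκ x).choose
  map_add' x y := hκ.ext fun a => Subtype.ext <| by
    rw [map_add (contract _ _)]
    refine ((exists_coaction hκ (x + y)).choose_spec a).trans ?_
    rw [Submodule.coe_add, Submodule.coe_add, (exists_coaction hκ x).choose_spec,
      (exists_coaction hκ y).choose_spec, map_add]
  map_smul' r x := hκ.ext fun a => Subtype.ext <| by
    rw [map_smul (contract _ _)]
    refine ((exists_coaction hκ (r • x)).choose_spec a).trans ?_
    rw [RingHom.id_apply, Submodule.coe_smul, Submodule.coe_smul,
      (exists_coaction hκ x).choose_spec, map_smul]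

theorem contract_ratCoact (hκ : AlphaCondition κ) (x : Rat κ τ) (a : A) :
    (contract (MeasuringPairing.toDual κ a) (Rat κ τ) (ratCoact hκ x) : X) = τ a x :=
  (exists_coaction hκ x).choose_spec a

theorem ratCoact_coassoc (hκ : AlphaCondition κ) (x : Rat κ τ) :
    TensorProduct.assoc R (Rat κ τ) D D ((ratCoact hκ).rTensor D (ratCoact hκ x)) =
      (comul (R := R) (A := D)).lTensor (Rat κ τ) (ratCoact hκ x) := by
  apply (TensorProduct.assoc R (Rat κ τ) D D).symm.injective
  -- Contracting the last factor with `b` and the middle one with `a` leaves $a(bx)$ on the left and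
  -- $(ab)x$ on the right.
  refine hκ.ext fun b => hκ.ext fun a => Subtype.ext ?_
  rw [LinearEquiv.symm_apply_apply, contract_rTensor, ← contract_toDual_mul, contract_ratCoact,
    contract_ratCoact, contract_ratCoact, map_mul, Module.End.mul_apply]

theorem contract_counit_ratCoact (hκ : AlphaCondition κ) (x : Rat κ τ) :
    contract (counit (R := R) (A := D)) (Rat κ τ) (ratCoact hκ x) = x := by
  apply Subtype.ext
  rw [← toDual_one κ, contract_ratCoact, map_one, Module.End.one_apply]

end Rational

/-! ### Duality of entwining structures -/

section Duality

variable {R : Type u} [CommRing R]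
  {A C : Type u} [Semiring A] [Algebra R A] [AddCommMonoid C] [Module R C]
  {D : Type u} [AddCommMonoid D] [Module R D] [Coalgebra R D]

/-- Pairing `∑ a_0 b_ψ ⊗ c_0^ψ` with elements of the dual side, for `∑ a_0 ⊗ c_0 ∈ A ⊗ C`. -/
theorem toDual_contract_mul_side (κ : MeasuringPairing R A D) (ψ : C ⊗[R] A →ₗ[R] A ⊗[R] C)
    (f : Module.Dual R C) (g : D → Module.Dual R C) (a : A)
    (hg : ∀ d c, MeasuringPairing.toDual κ (contract f A (ψ (c ⊗ₜ a))) d = g d c)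
    {d : D} {ι : Type*} (r : Finset ι) (d₁ d₂ : ι → D)
    (hd : ∑ i ∈ r, d₁ i ⊗ₜ[R] d₂ i = comul d) (s : A ⊗[R] C) :
    MeasuringPairing.toDual κ (contract f A ((LinearMap.mul' R A).rTensor C
      ((TensorProduct.assoc R A A C).symm
        (ψ.lTensor A (TensorProduct.assoc R A C A (s ⊗ₜ a)))))) d =
      ∑ i ∈ r, MeasuringPairing.toDual κ (contract (g (d₂ i)) A s) (d₁ i) := by
  rw [contract_rTensor]
  induction s with
  | zero => simp
  | tmul b c =>
    -- Evaluation at `d` splits the product $b\,a_\psi$ as $\sum\langle b,d_1\rangle\langle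
    -- a_\psi,d_2\rangle$; the second factor together with `f` is the functional `g` at $d_2$.
    rw [TensorProduct.assoc_tmul, LinearMap.lTensor_tmul, contract_assoc_symm_tmul,
      LinearMap.mul'_apply, toDual_mul, LinearMap.comp_apply, ← hd]
    simp [hg, mul_comm]
  | add x y hx hy =>
    simp only [map_add, TensorProduct.add_tmul, hx, hy, LinearMap.add_apply,
      Finset.sum_add_distrib]

variable [Coalgebra R C] {B : Type u} [Semiring B] [Algebra R B]
  {κ : MeasuringPairing R A D} {κ' : MeasuringPairing R B C}
  {ψ : C ⊗[R] A →ₗ[R] A ⊗[R] C} {φ : D ⊗[R] B →ₗ[R] B ⊗[R] D}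

/-- The maps `ψ` and `φ` are dual to each other with respect to pairings `(A, D)` and `(B, C)`:
`∑ <b_φ, c> <a, d^φ> = ∑ <a_ψ, d> <b, c^ψ>`. -/
def IsDualPair (κ : MeasuringPairing R A D) (κ' : MeasuringPairing R B C)
    (ψ : C ⊗[R] A →ₗ[R] A ⊗[R] C) (φ : D ⊗[R] B →ₗ[R] B ⊗[R] D) : Prop :=
  ∀ (a : A) (b : B) (c : C) (d : D),
    MeasuringPairing.toDual κ' (contract (MeasuringPairing.toDual κ a) B (φ (d ⊗ₜ b))) c =
      MeasuringPairing.toDual κ (contract (MeasuringPairing.toDual κ' b) A (ψ (c ⊗ₜ a))) d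

/-- This symmetry lets every result on duals of modules over `ψ` apply to modules over `φ`. -/
theorem IsDualPair.symm (h : IsDualPair κ κ' ψ φ) : IsDualPair κ' κ φ ψ :=
  fun b a d c => (h a b c d).symm

/-- Contracting `∑ a_{ψΨ} ⊗ c_1^Ψ ⊗ c_2^ψ`. -/
theorem contract_contract_comul_side (ψ : C ⊗[R] A →ₗ[R] A ⊗[R] C) (f g : Module.Dual R C)
    {c : C} {ι : Type*} (r : Finset ι) (c₁ c₂ : ι → C)
    (hc : ∑ i ∈ r, c₁ i ⊗ₜ[R] c₂ i = comul c) (a : A) :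
    contract f A (contract g (A ⊗[R] C) ((TensorProduct.assoc R A C C).symm
      (TensorProduct.assoc R A C C (ψ.rTensor C ((TensorProduct.assoc R C A C).symm
        (ψ.lTensor C (TensorProduct.assoc R C C A (comul (R := R) c ⊗ₜ a)))))))) =
      ∑ i ∈ r, contract f A (ψ (c₁ i ⊗ₜ contract g A (ψ (c₂ i ⊗ₜ a)))) := by
  rw [LinearEquiv.symm_apply_apply, contract_rTensor, ← hc]
  simp only [TensorProduct.sum_tmul, map_sum, TensorProduct.assoc_tmul, LinearMap.lTensor_tmul,
    contract_assoc_symm_tmul]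

/-- The dual of an entwining structure is an entwining structure. -/
theorem IsDualPair.isEntwining (h : IsDualPair κ κ' ψ φ) (hκ : AlphaCondition κ)
    (hκ' : Function.Injective (MeasuringPairing.toDual κ')) (hψ : IsEntwining ψ) :
    IsEntwining φ where
  map_mul d b b' := by
    refine hκ.ext fun a => hκ' (LinearMap.ext fun c => ?_)
    have r := Coalgebra.Repr.arbitrary R c
    -- Multiplicativity of `φ` becomes the comultiplication axiom of `ψ`: both sides expand into
    -- sums over $\Delta(c)$, whose terms agree by duality.
    rw [toDual_contract_mul_side κ' φ (MeasuringPairing.toDual κ a) _ b'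
      (fun c d => h a b' c d) r.index r.left r.right r.eq, h, contract_toDual_mul, hψ.comul,
      contract_contract_comul_side ψ _ _ r.index r.left r.right r.eq, map_sum, LinearMap.sum_apply]
    exact Finset.sum_congr rfl fun i _ => (h _ _ _ _).symm
  map_one d := by
    refine hκ.ext fun a => hκ' (LinearMap.ext fun c => ?_)
    rw [h, toDual_one, hψ.counit]
    simp [toDual_one, mul_comm]
  comul d b := by
    apply (TensorProduct.assoc R B D D).symm.injective
    refine hκ.ext fun a' => hκ.ext fun a => hκ' (LinearMap.ext fun c => ?_)
    have r := Coalgebra.Repr.arbitrary R d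
    -- Dually, contracting with `a` and `a'` turns the comultiplication of `D` into the product
    -- $aa'$, and multiplicativity of `ψ` applies.
    rw [contract_contract_comul_side φ _ _ r.index r.left r.right r.eq, ← contract_toDual_mul, h,
      hψ.map_mul, toDual_contract_mul_side κ ψ (MeasuringPairing.toDual κ' b) _ a'
      (fun d c => h.symm b a' d c) r.index r.left r.right r.eq, map_sum, LinearMap.sum_apply]
    exact Finset.sum_congr rfl fun i _ => (h _ _ _ _).symm
  counit d b := by
    refine hκ' (LinearMap.ext fun c => ?_)
    rw [← toDual_one κ, h, hψ.map_one]
    simp [toDual_one, mul_comm]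

end Duality

/-! ### Duals of entwined modules -/

section DualModule

variable {R : Type u} [CommRing R]
  {A C : Type u} [Semiring A] [Algebra R A] [AddCommMonoid C] [Module R C] [Coalgebra R C]
  {B D : Type u} [Semiring B] [Algebra R B] [AddCommMonoid D] [Module R D] [Coalgebra R D]
  {κ : MeasuringPairing R A D} {κ' : MeasuringPairing R B C}
  {ψ : C ⊗[R] A →ₗ[R] A ⊗[R] C} {φ : D ⊗[R] B →ₗ[R] B ⊗[R] D}
  {M : Type u} [AddCommGroup M] [Module R M]

theorem dualLeft_apply (σ : Aᵐᵒᵖ →ₐ[R] Module.End R M) (a : A) (h : Module.Dual R M) (m : M) :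
    dualLeft σ a h m = h (rightAction σ m a) := rfl

theorem comoduleAction_apply (κ' : MeasuringPairing R B C) (ρ : M →ₗ[R] M ⊗[R] C) (b : B)
    (m : M) : comoduleAction κ' ρ b m = contract (MeasuringPairing.toDual κ' b) M (ρ m) := rfl

theorem comoduleAction_one (κ' : MeasuringPairing R B C) (X : EntwinedModule ψ M) :
    comoduleAction κ' X.coact 1 = 1 := by
  ext m
  rw [comoduleAction_apply, toDual_one, X.coact_counit, Module.End.one_apply]

theorem comoduleAction_mul (κ' : MeasuringPairing R B C) (X : EntwinedModule ψ M) (b b' : B) :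
    comoduleAction κ' X.coact (b * b') =
      comoduleAction κ' X.coact b * comoduleAction κ' X.coact b' := by
  ext m
  rw [Module.End.mul_apply, comoduleAction_apply, comoduleAction_apply, comoduleAction_apply,
    contract_toDual_mul, ← X.coassoc, LinearEquiv.symm_apply_apply, contract_rTensor]

/-- The right `B`-module structure `(h b)(m) = ∑ h(m_0) <b, m_1>` on `M^*`. -/
noncomputable def dualRight (κ' : MeasuringPairing R B C) (X : EntwinedModule ψ M) :
    Bᵐᵒᵖ →ₐ[R] Module.End R (Module.Dual R M) :=
  AlgHom.ofLinearMap
    { toFun := fun b => (comoduleAction κ' X.coact b.unop).dualMap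
      map_add' := fun a b => by ext; simp
      map_smul' := fun r a => by ext; simp }
    (by ext; simp [comoduleAction_one])
    (fun a b => by ext; simp [comoduleAction_mul])

theorem dualRight_apply (κ' : MeasuringPairing R B C) (X : EntwinedModule ψ M) (b : B)
    (h : Module.Dual R M) (m : M) : rightAction (dualRight κ' X) h b m =
      h (contract (MeasuringPairing.toDual κ' b) M (X.coact m)) := rfl

/-- The identity `a (h b) = ∑ (h_0 b_φ) <a, h_1^φ>`, where the functionals are the values of a
linear map `i : S → M^*` respecting the right action of `B`. -/
theorem IsDualPair.contract_entwine (hd : IsDualPair κ κ' ψ φ) (X : EntwinedModule ψ M)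
    {S : Type u} [AddCommMonoid S] [Module R S] (i : S →ₗ[R] Module.Dual R M)
    (act : S →ₗ[R] B →ₗ[R] S)
    (hi : ∀ s b, i (act s b) = rightAction (dualRight κ' X) (i s) b)
    (h : Module.Dual R M) (t : S ⊗[R] D)
    (ht : ∀ a, i (contract (MeasuringPairing.toDual κ a) S t) = dualLeft X.act a h)
    (b : B) (a : A) :
    i (contract (MeasuringPairing.toDual κ a) S ((TensorProduct.lift act).rTensor D
      ((TensorProduct.assoc R S B D).symm
        (φ.lTensor S (TensorProduct.assoc R S D B (t ⊗ₜ b)))))) =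
      dualLeft X.act a (rightAction (dualRight κ' X) h b) := by
  ext m
  rw [dualLeft_apply, dualRight_apply, X.compat, contract_rTensor, contract_rTensor]
  obtain ⟨T, hT⟩ := TensorProduct.exists_finset (X.coact m)
  -- The hypothesis `ht` concerns the whole tensor and is lost on its summands. So the left side is
  -- first rewritten, for arbitrary `t`, through contractions with the elements $a_\psi\langle
  -- b,m_1^\psi\rangle$ of `A`; `ht` enters only afterwards.
  have key : ∀ t : S ⊗[R] D,
      i (TensorProduct.lift act (contract (MeasuringPairing.toDual κ a) (S ⊗[R] B)
        ((TensorProduct.assoc R S B D).symm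
          (φ.lTensor S (TensorProduct.assoc R S D B (t ⊗ₜ b)))))) m =
        ∑ p ∈ T, i (contract (MeasuringPairing.toDual κ
          (contract (MeasuringPairing.toDual κ' b) A (ψ (p.2 ⊗ₜ a)))) S t) p.1 := by
    intro t
    induction t with
    | zero => simp
    | tmul s d =>
      rw [TensorProduct.assoc_tmul, LinearMap.lTensor_tmul, contract_assoc_symm_tmul,
        TensorProduct.lift.tmul, hi, dualRight_apply, hT]
      simp only [map_sum, contract_tmul, map_smul, LinearMap.smul_apply, hd a b]
    | add x y hx hy =>
      simp only [map_add, TensorProduct.add_tmul, hx, hy, LinearMap.add_apply,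
        Finset.sum_add_distrib]
  rw [key, hT]
  simp only [ht, dualLeft_apply, TensorProduct.sum_tmul, map_sum, TensorProduct.assoc_tmul,
    LinearMap.lTensor_tmul, contract_assoc_symm_tmul, TensorProduct.lift.tmul]

/-- Here `contract_entwine` is used with $S=M^*$, as $hb$ is not yet known to be rational; the
entwined tensor itself is the witness. -/
theorem IsDualPair.rightAction_mem_ratDual (hd : IsDualPair κ κ' ψ φ) (X : EntwinedModule ψ M)
    {h : Module.Dual R M} (hh : h ∈ ratDual κ X) (b : B) :
    rightAction (dualRight κ' X) h b ∈ ratDual κ X := by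
  obtain ⟨t, ht⟩ := mem_Rat_iff.1 hh
  exact mem_Rat_iff.2 ⟨_, hd.contract_entwine X LinearMap.id (rightAction (dualRight κ' X))
    (fun _ _ => rfl) h t ht b⟩

/-- The entwined module structure on the rational part of the dual of an entwined module. -/
noncomputable def IsDualPair.dualModule (hd : IsDualPair κ κ' ψ φ) (hκ : AlphaCondition κ)
    (X : EntwinedModule ψ M) : EntwinedModule φ (ratDual κ X) where
  act := AlgHom.ofLinearMap
    { toFun := fun b => (dualRight κ' X b).restrict
        fun _ hh => hd.rightAction_mem_ratDual X hh b.unop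
      map_add' := fun a b => LinearMap.ext fun h => Subtype.ext <|
        LinearMap.congr_fun (map_add (dualRight κ' X) a b) h.1
      map_smul' := fun r a => LinearMap.ext fun h => Subtype.ext <|
        LinearMap.congr_fun (map_smul (dualRight κ' X) r a) h.1 }
    (LinearMap.ext fun h => Subtype.ext <| LinearMap.congr_fun (map_one (dualRight κ' X)) h.1)
    (fun a b => LinearMap.ext fun h => Subtype.ext <|
      LinearMap.congr_fun (map_mul (dualRight κ' X) a b) h.1)
  coact := ratCoact hκ
  coassoc := ratCoact_coassoc hκ
  coact_counit := contract_counit_ratCoact hκ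
  compat h b := hκ.ext fun a => Subtype.ext <| by
    refine (contract_ratCoact hκ _ a).trans ?_
    -- The same identity, now with `S` the rational part, so that the tensor already lies where the
    -- coaction takes its values.
    exact (hd.contract_entwine X (ratDual κ X).subtype _ (fun _ _ => rfl) h (ratCoact hκ h)
      (contract_ratCoact hκ h) b a).symm

theorem IsDualPair.isDualStructure_dualModule (hd : IsDualPair κ κ' ψ φ)
    (hκ : AlphaCondition κ) (X : EntwinedModule ψ M) :
    IsDualStructure κ κ' X (hd.dualModule hκ X) where
  act_eq _ _ _ := rfl
  coact_eq := contract_ratCoact hκ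

theorem IsDualStructure.eq {X : EntwinedModule ψ M} (hκ : AlphaCondition κ)
    {Y Y' : EntwinedModule φ (ratDual κ X)} (hY : IsDualStructure κ κ' X Y)
    (hY' : IsDualStructure κ κ' X Y') : Y = Y' := by
  apply EntwinedModule.ext
  · ext b h m
    exact (hY.act_eq h b.unop m).trans (hY'.act_eq h b.unop m).symm
  · ext1 h
    exact hκ.ext fun a => Subtype.ext ((hY.coact_eq h a).trans (hY'.coact_eq h a).symm)

theorem IsDualPair.existsUnique_isDualStructure (hd : IsDualPair κ κ' ψ φ)
    (hκ : AlphaCondition κ) (X : EntwinedModule ψ M) :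
    ∃! Y : EntwinedModule φ (ratDual κ X), IsDualStructure κ κ' X Y :=
  ⟨hd.dualModule hκ X, hd.isDualStructure_dualModule hκ X,
    fun _ hY => hY.eq hκ (hd.isDualStructure_dualModule hκ X)⟩

variable {N : Type u} [AddCommGroup N] [Module R N] {X₁ : EntwinedModule ψ M}
  {X₂ : EntwinedModule ψ N} {f : M →ₗ[R] N}

theorem IsEntwinedHom.dualMap_dualLeft (hf : IsEntwinedHom X₁ X₂ f) (a : A)
    (h : Module.Dual R N) : f.dualMap (dualLeft X₂.act a h) = dualLeft X₁.act a (f.dualMap h) := by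
  ext m
  simp only [LinearMap.dualMap_apply, dualLeft_apply, hf.linear]

theorem IsEntwinedHom.dualMap_mem_ratDual (hf : IsEntwinedHom X₁ X₂ f) {h : Module.Dual R N}
    (hh : h ∈ ratDual κ X₂) : f.dualMap h ∈ ratDual κ X₁ := by
  obtain ⟨t, ht⟩ := mem_Rat_iff.1 hh
  refine mem_Rat_iff.2 ⟨f.dualMap.rTensor D t, fun a => ?_⟩
  rw [contract_rTensor, ht, hf.dualMap_dualLeft]

/-- The two properties trade places: `B`-linearity of the dual map comes from colinearity of `f`,
and `D`-colinearity from its `A`-linearity. -/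
theorem IsEntwinedHom.dualMap_restrict (hκ : AlphaCondition κ) (hf : IsEntwinedHom X₁ X₂ f)
    (hm : ∀ h ∈ ratDual κ X₂, f.dualMap h ∈ ratDual κ X₁)
    {Y₁ : EntwinedModule φ (ratDual κ X₁)} {Y₂ : EntwinedModule φ (ratDual κ X₂)}
    (hY₁ : IsDualStructure κ κ' X₁ Y₁) (hY₂ : IsDualStructure κ κ' X₂ Y₂) :
    IsEntwinedHom Y₂ Y₁ (f.dualMap.restrict hm) where
  linear h b := by
    ext m
    rw [hY₁.act_eq, LinearMap.coe_restrict_apply, LinearMap.coe_restrict_apply,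
      LinearMap.dualMap_apply, LinearMap.dualMap_apply, hY₂.act_eq, comoduleAction_apply,
      comoduleAction_apply, hf.colinear, contract_rTensor]
  colinear h := hκ.ext fun a => Subtype.ext <| by
    rw [contract_rTensor, LinearMap.coe_restrict_apply]
    refine (hY₁.coact_eq _ a).trans ?_
    rw [LinearMap.coe_restrict_apply, ← hf.dualMap_dualLeft]
    exact congrArg f.dualMap (hY₂.coact_eq h a).symm

end DualModule

/-! ### The finite dual and the main theorem -/

section Main

variable {R : Type u} [CommRing R]

theorem FiniteDualSubcoalgebra.alphaCondition_pairing [IsNoetherianRing R] {A : Type u} [Ring A]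
    [Algebra R A] [IsAlphaAlgebra R A] (D : FiniteDualSubcoalgebra R A) :
    AlphaCondition D.pairing :=
  fun _ _ _ _ _ h => D.eq_of_contract_eval fun a => LinearMap.congr_fun h a

theorem toDual_inclusionPairing_injective {C : Type u} [AddCommMonoid C] [Module R C]
    [Coalgebra R C] (B : Subalgebra R (WithConv (C →ₗ[R] R))) :
    Function.Injective (MeasuringPairing.toDual (inclusionPairing B)) :=
  (WithConv.linearEquiv R (C →ₗ[R] R)).injective.comp Subtype.val_injective

theorem dualDistrib_map_tmul {B C D E : Type u} [AddCommMonoid B] [Module R B] [AddCommMonoid C]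
    [Module R C] [AddCommMonoid D] [Module R D] [AddCommMonoid E] [Module R E]
    (i : B →ₗ[R] Module.Dual R C) (j : D →ₗ[R] Module.Dual R E) (t : B ⊗[R] D) (c : C) (e : E) :
    TensorProduct.dualDistrib R C E (TensorProduct.map i j t) (c ⊗ₜ e) =
      i (contract (j.flip e) B t) c := by
  induction t with
  | zero => simp
  | tmul b d => simp [mul_comm]
  | add x y hx hy => simp only [map_add, LinearMap.add_apply, hx, hy]

theorem dualDistrib_tmul_eq_contract {A C : Type u} [AddCommMonoid A] [Module R A]
    [AddCommMonoid C] [Module R C] (f : Module.Dual R A) (g : Module.Dual R C) (s : A ⊗[R] C) :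
    TensorProduct.dualDistrib R A C (f ⊗ₜ g) s = f (contract g A s) := by
  induction s with
  | zero => simp
  | tmul a c => simp [mul_comm]
  | add x y hx hy => simp only [map_add, hx, hy]

end Main

end DualEntwining

theorem mainTheorem8 {R : Type u} [CommRing R] [IsNoetherianRing R]
    {A C : Type u} [Ring A] [Algebra R A] [DualEntwining.IsAlphaAlgebra R A]
    [AddCommGroup C] [Module R C] [Coalgebra R C]
    (ψ : C ⊗[R] A →ₗ[R] A ⊗[R] C) (_hψ : DualEntwining.IsEntwining ψ)
    (A' : Subalgebra R (WithConv (C →ₗ[R] R)))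
    (C' : DualEntwining.FiniteDualSubcoalgebra R A)
    (φ : C'.toSubmodule ⊗[R] A' →ₗ[R] A' ⊗[R] C'.toSubmodule)
    (_hφ : ∀ t : C'.toSubmodule ⊗[R] A',
      TensorProduct.dualDistrib R C A
          (TensorProduct.map (DualEntwining.MeasuringPairing.toDual (DualEntwining.inclusionPairing A'))
            C'.toSubmodule.subtype (φ t)) =
        TensorProduct.dualDistrib R A C
          (TensorProduct.map C'.toSubmodule.subtype
            (DualEntwining.MeasuringPairing.toDual (DualEntwining.inclusionPairing A')) t) ∘ₗ ψ) :
    DualEntwining.IsEntwining φ ∧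
    (∀ (M : Type u) [AddCommGroup M] [Module R M] (X : DualEntwining.EntwinedModule ψ M),
      ∃! Y : DualEntwining.EntwinedModule φ (DualEntwining.ratDual C'.pairing X),
        DualEntwining.IsDualStructure C'.pairing (DualEntwining.inclusionPairing A') X Y) ∧
    (∀ (M N : Type u) [AddCommGroup M] [Module R M] [AddCommGroup N] [Module R N]
      (X₁ : DualEntwining.EntwinedModule ψ M) (X₂ : DualEntwining.EntwinedModule ψ N)
      (f : M →ₗ[R] N), DualEntwining.IsEntwinedHom X₁ X₂ f →
      ∃ hf : ∀ h ∈ DualEntwining.ratDual C'.pairing X₂,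
          f.dualMap h ∈ DualEntwining.ratDual C'.pairing X₁,
        ∀ (Y₁ : DualEntwining.EntwinedModule φ (DualEntwining.ratDual C'.pairing X₁))
          (Y₂ : DualEntwining.EntwinedModule φ (DualEntwining.ratDual C'.pairing X₂)),
          DualEntwining.IsDualStructure C'.pairing (DualEntwining.inclusionPairing A') X₁ Y₁ →
          DualEntwining.IsDualStructure C'.pairing (DualEntwining.inclusionPairing A') X₂ Y₂ →
          DualEntwining.IsEntwinedHom Y₂ Y₁ (f.dualMap.restrict hf)) ∧
    (DualEntwining.AlphaCondition (DualEntwining.inclusionPairing A') →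
      (∀ (K : Type u) [AddCommGroup K] [Module R K] (X : DualEntwining.EntwinedModule φ K),
        ∃! Y : DualEntwining.EntwinedModule ψ (DualEntwining.ratDual (DualEntwining.inclusionPairing A') X),
          DualEntwining.IsDualStructure (DualEntwining.inclusionPairing A') C'.pairing X Y) ∧
      (∀ (K L : Type u) [AddCommGroup K] [Module R K] [AddCommGroup L] [Module R L]
        (X₁ : DualEntwining.EntwinedModule φ K) (X₂ : DualEntwining.EntwinedModule φ L)
        (g : K →ₗ[R] L), DualEntwining.IsEntwinedHom X₁ X₂ g →
        ∃ hg : ∀ h ∈ DualEntwining.ratDual (DualEntwining.inclusionPairing A') X₂,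
            g.dualMap h ∈ DualEntwining.ratDual (DualEntwining.inclusionPairing A') X₁,
          ∀ (Y₁ : DualEntwining.EntwinedModule ψ (DualEntwining.ratDual (DualEntwining.inclusionPairing A') X₁))
            (Y₂ : DualEntwining.EntwinedModule ψ (DualEntwining.ratDual (DualEntwining.inclusionPairing A') X₂)),
            DualEntwining.IsDualStructure (DualEntwining.inclusionPairing A') C'.pairing X₁ Y₁ →
            DualEntwining.IsDualStructure (DualEntwining.inclusionPairing A') C'.pairing X₂ Y₂ →
            DualEntwining.IsEntwinedHom Y₂ Y₁ (g.dualMap.restrict hg))) := by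
  have hd : DualEntwining.IsDualPair C'.pairing (DualEntwining.inclusionPairing A') ψ φ := by
    intro a b c f
    -- On pure tensors the hypothesis on `φ` is exactly the duality identity.
    have h := LinearMap.congr_fun (_hφ (f ⊗ₜ b)) (c ⊗ₜ a)
    rw [DualEntwining.dualDistrib_map_tmul, LinearMap.comp_apply, TensorProduct.map_tmul,
      DualEntwining.dualDistrib_tmul_eq_contract] at h
    exact h
  have hκ := C'.alphaCondition_pairing
  exact ⟨hd.isEntwining hκ (DualEntwining.toDual_inclusionPairing_injective A') _hψ,
    fun M _ _ X => hd.existsUnique_isDualStructure hκ X,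
    fun M N _ _ _ _ X₁ X₂ f hf => ⟨fun _ hh => hf.dualMap_mem_ratDual hh,
      fun Y₁ Y₂ hY₁ hY₂ => hf.dualMap_restrict hκ _ hY₁ hY₂⟩,
    -- The second half: the duality is reversed, and `hκ'` replaces the α-condition of the finite
    -- dual.
    fun hκ' => ⟨fun K _ _ X => hd.symm.existsUnique_isDualStructure hκ' X,
      fun K L _ _ _ _ X₁ X₂ g hg => ⟨fun _ hh => hg.dualMap_mem_ratDual hh,
        fun Y₁ Y₂ hY₁ hY₂ => hg.dualMap_restrict hκ' _ hY₁ hY₂⟩⟩⟩
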